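/- Let $X$ be a non-empty finite set and let $r\colon X\times X\to X\times X$, $r(x,y)=(\sigma_x(y),\tau_y(x))$, be a bijective map satisfying the Yang--Baxter equation $r_1r_2r_1=r_2r_1r_2$ on $X\times X\times X$, where $r_1=r\times\mathrm{id}$ and $r_2=\mathrm{id}\times r$. Assume that $(X,r)$ is non-degenerate, i.e. all the maps $\sigma_x$ and $\tau_x$ are bijective. Let $$G(X,r)=\langle X\mid xy=\sigma_x(y)\tau_y(x)\text{ for all }x,y\in X\rangle$$ be its structure group, with group operation $\circ$, and let $\iota\colon X\to G(X,r)$ be the canonical map. Consider $G(X,r)$ with its canonical structure of a skew left brace, i.e. with the group operation $+$ such that $a\circ(b+c)=a\circ b-a+a\circ c$ for all $a,b,c$ and such that $r_G(\iota(x),\iota(y))=(\iota(\sigma_x(y)),\iota(\tau_y(x)))$ for all $x,y\in X$, where $r_G(a,b)=(\lambda_a(b),\lambda_a(b)'\circ a\circ b)$, $\lambda_a(b)=-a+a\circ b$, and $'$ denotes the inverse with respect to $\circ$. Its additive group is isomorphic to $$A(X,r)=\langle X\mid x+\sigma_x(y)=\sigma_x(y)+\sigma_{\sigma_x(y)}(\tau_y(x))\text{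 for all }x,y\in X\rangle.$$ Put $a*b=-a+a\circ b-b$, and let $G(X,r)*G(X,r)$ be the additive subgroup of $G(X,r)$ generated by all elements $a*b$ with $a,b\in G(X,r)$. Put $y\triangleright x=\sigma_y(\tau_{\sigma_x^{-1}(y)}(x))$ for $x,y\in X$, and suppose that the derived solution $(x,y)\mapsto(y,y\triangleright x)$ is indecomposable, i.e. that the group generated by the permutations $x\mapsto y\triangleright x$, $y\in X$, acts transitively on $X$. Then $G(X,r)*G(X,r)$ is finite. Moreover, if $G(X,r)$ is not isomorphic, as a skew left brace, to the trivial skew left brace $(\mathbb{Z},+,+)$ (in particular, if the structure group $G(X,r)$ is not isomorphic to $\mathbb{Z}$), then the multiplicative group of $G(X,r)$ has torsion, i.e. it contains a non-identity element of finite order. -/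

import Mathlib

/-- A skew left brace: `(A, +)` and `(A, *)` are (not necessarily abelian) groups with
`a ∘ (b + c) = a ∘ b - a + a ∘ c`. The circle operation `∘` is written as multiplication. -/
class SkewLeftBrace (A : Type*) extends Group A, AddGroup A where
  mul_add_eq : ∀ a b c : A, a * (b + c) = a * b - a + a * c

namespace SkewLeftBrace

variable {A : Type*} [SkewLeftBrace A]

/-- `λ_a(b) = -a + a ∘ b`. -/
def lam (a b : A) : A := -a + a * b

/-- The operation `a * b = -a + a ∘ b - b` of a skew left brace. -/
def star (a b : A) : A := -a + a * b - b

/-- The map `r_A(a, b) = (λ_a(b), λ_a(b)' ∘ a ∘ b)`, where `'` is the inverse for `∘`. -/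
def braceMap (p : A × A) : A × A := (lam p.1 p.2, (lam p.1 p.2)⁻¹ * p.1 * p.2)

variable (A) in
/-- `A * A`, also written `A^(2)`: the additive subgroup generated by all `a * b`. -/
def starSubgroup : AddSubgroup A :=
  AddSubgroup.closure {c : A | ∃ a b : A, c = star a b}

/-- `A` is isomorphic, as a skew left brace, to the trivial skew left brace `(B, +, +)`. -/
def IsIsoTrivial (A : Type*) [SkewLeftBrace A] (B : Type*) [AddGroup B] : Prop :=
  ∃ e : A ≃ B, ∀ a b : A, e (a + b) = e a + e b ∧ e (a * b) = e a + e b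

end SkewLeftBrace

/-- A (bijective, set-theoretic) solution `(X, r)` of the Yang-Baxter equation
`r₁ r₂ r₁ = r₂ r₁ r₂`, where `r₁ = r × id` and `r₂ = id × r` on `X × X × X`. -/
structure YBSolution (X : Type*) where
  r : X × X → X × X
  bijective : Function.Bijective r
  yang_baxter :
    let r₁ : X × X × X → X × X × X :=
      fun p => ((r (p.1, p.2.1)).1, (r (p.1, p.2.1)).2, p.2.2)
    let r₂ : X × X × X → X × X × X := fun p => (p.1, r p.2)
    r₁ ∘ r₂ ∘ r₁ = r₂ ∘ r₁ ∘ r₂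

namespace YBSolution

variable {X : Type*} (S : YBSolution X)

/-- `r (x, y) = (σ_x(y), τ_y(x))`. -/
def sigma (x y : X) : X := (S.r (x, y)).1

/-- `r (x, y) = (σ_x(y), τ_y(x))`. -/
def tau (y x : X) : X := (S.r (x, y)).2

/-- All the maps `σ_x` and `τ_x` are bijective. -/
class NonDegenerate : Prop where
  sigma_bijective : ∀ x, Function.Bijective (S.sigma x)
  tau_bijective : ∀ x, Function.Bijective (S.tau x)

/-- The defining relations `x y = σ_x(y) τ_y(x)` of the structure group. -/
def structureRels : Set (FreeGroup X) :=
  {w | ∃ x y : X, w = (FreeGroup.of x * FreeGroup.of y) *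
    (FreeGroup.of (S.sigma x y) * FreeGroup.of (S.tau y x))⁻¹}

/-- The structure group `G(X, r)`. -/
def StructureGroup : Type _ := PresentedGroup S.structureRels

instance : Group S.StructureGroup :=
  inferInstanceAs (Group (PresentedGroup S.structureRels))

/-- The canonical map `X → G(X, r)`. -/
def iota (x : X) : S.StructureGroup := PresentedGroup.of (rels := S.structureRels) x

/-- The defining relations of `A(X, r)`. -/
def additiveRels : Set (FreeGroup X) :=
  {w | ∃ x y : X, w = (FreeGroup.of x * FreeGroup.of (S.sigma x y)) *
    (FreeGroup.of (S.sigma x y) * FreeGroup.of (S.sigma (S.sigma x y) (S.tau y x)))⁻¹}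

/-- The group `A(X, r)`, here in multiplicative notation, with generators `X` and relations
`x + σ_x(y) = σ_x(y) + σ_{σ_x(y)}(τ_y(x))`. -/
abbrev DerivedGroup : Type _ := PresentedGroup S.additiveRels

/-! ### Components of the Yang-Baxter equation -/

theorem sigma_sigma (x y z : X) :
    S.sigma x (S.sigma y z) = S.sigma (S.sigma x y) (S.sigma (S.tau y x) z) :=
  (congrArg Prod.fst (congrFun S.yang_baxter (x, y, z))).symm

theorem tau_sigma (x y z : X) :
    S.tau (S.sigma (S.tau y x) z) (S.sigma x y) =
      S.sigma (S.tau (S.sigma y z) x) (S.tau z y) :=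
  congrArg (fun p => p.2.1) (congrFun S.yang_baxter (x, y, z))

theorem tau_tau (x y z : X) :
    S.tau z (S.tau y x) = S.tau (S.tau z y) (S.tau (S.sigma y z) x) := by
  have h := congrArg (fun p => p.2.2) (congrFun S.yang_baxter (x, y, z))
  exact h

theorem iota_mul (x y : X) :
    S.iota x * S.iota y = S.iota (S.sigma x y) * S.iota (S.tau y x) :=
  mul_inv_eq_one.1 (PresentedGroup.one_of_mem (rels := S.structureRels) ⟨x, y, rfl⟩)

theorem structureGroup_induction {p : S.StructureGroup → Prop} (g : S.StructureGroup)
    (iota : ∀ x, p (S.iota x)) (one : p 1) (mul : ∀ g h, p g → p h → p (g * h))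
    (inv : ∀ g, p g → p g⁻¹) : p g :=
  PresentedGroup.generated_by S.structureRels
    { carrier := {g | p g}, mul_mem' := fun {a b} => mul a b, one_mem' := one,
      inv_mem' := fun {a} => inv a } iota g

theorem structureGroup_hom_ext {G : Type*} [Group G] {f f' : S.StructureGroup →* G}
    (h : ∀ x, f (S.iota x) = f' (S.iota x)) : f = f' :=
  PresentedGroup.ext (rels := S.structureRels) h

theorem derivedGroup_induction {p : S.DerivedGroup → Prop} (a : S.DerivedGroup)
    (of : ∀ x, p (PresentedGroup.of x)) (one : p 1) (mul : ∀ a b, p a → p b → p (a * b))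
    (inv : ∀ a, p a → p a⁻¹) : p a :=
  PresentedGroup.generated_by S.additiveRels
    { carrier := {g | p g}, mul_mem' := fun {a b} => mul a b, one_mem' := one,
      inv_mem' := fun {a} => inv a } of a

section NonDegenerate

variable [hS : S.NonDegenerate]

/-- `σ_x` as a permutation of `X`. -/
noncomputable def sigmaPerm (x : X) : Equiv.Perm X :=
  Equiv.ofBijective (S.sigma x) (hS.sigma_bijective x)

@[simp] theorem sigmaPerm_apply (x y : X) : S.sigmaPerm x y = S.sigma x y := rfl

/-- `y ▷ x = σ_y(τ_{σ_x⁻¹(y)}(x))`. -/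
noncomputable def tri (y x : X) : X := S.sigma y (S.tau ((S.sigmaPerm x).symm y) x)

theorem tri_sigma (x y : X) :
    S.tri (S.sigma x y) x = S.sigma (S.sigma x y) (S.tau y x) := by
  have h : (S.sigmaPerm x).symm (S.sigma x y) = y := (S.sigmaPerm x).symm_apply_apply y
  simp only [tri, h]

theorem tri_bijective (y : X) : Function.Bijective (S.tri y) := by
  have key : ∀ x, S.r (x, (S.sigmaPerm x).symm y) =
      (y, S.tau ((S.sigmaPerm x).symm y) x) := fun x =>
    Prod.ext ((S.sigmaPerm x).apply_symm_apply y) rfl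
  refine (hS.sigma_bijective y).comp ⟨fun x x' h => ?_, fun z => ?_⟩
  · have h' : S.r (x, (S.sigmaPerm x).symm y) = S.r (x', (S.sigmaPerm x').symm y) := by
      rw [key, key]
      exact congrArg (Prod.mk y) h
    exact congrArg Prod.fst (S.bijective.1 h')
  · obtain ⟨⟨x, w⟩, hxw⟩ := S.bijective.2 (y, z)
    have hw : (S.sigmaPerm x).symm y = w :=
      (S.sigmaPerm x).symm_apply_eq.2 (congrArg Prod.fst hxw).symm
    exact ⟨x, by simp only [hw]; exact congrArg Prod.snd hxw⟩

/-- The permutation `x ↦ y ▷ x` of `X`. -/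
noncomputable def triPerm (y : X) : Equiv.Perm X :=
  Equiv.ofBijective (S.tri y) (S.tri_bijective y)

theorem sigma_tri (g z x : X) :
    S.sigma g (S.tri z x) = S.tri (S.sigma g z) (S.sigma g x) := by
  obtain ⟨y, rfl⟩ := (hS.sigma_bijective x).2 z
  rw [tri_sigma, S.sigma_sigma g x y, tri_sigma, tau_sigma, ← sigma_sigma, ← sigma_sigma]

theorem tri_tri (a b c : X) :
    S.tri c (S.tri b a) = S.tri (S.tri c b) (S.tri c a) := by
  obtain ⟨y, rfl⟩ := (hS.sigma_bijective a).2 b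
  obtain ⟨w, rfl⟩ := (hS.sigma_bijective a).2 c
  obtain ⟨z, rfl⟩ := (hS.sigma_bijective y).2 w
  rw [tri_sigma S a y, sigma_sigma S a y z, ← sigma_tri, tri_sigma,
    ← sigma_sigma S a y z, ← sigma_tri, tri_sigma S y z, tri_sigma S a,
    sigma_sigma S a (S.sigma y z), ← sigma_tri, tri_sigma, ← tau_tau, ← tau_sigma,
    sigma_sigma S (S.sigma a y), ← sigma_sigma S a y z]

/-- The derived solution `r_▷(x, y) = (y, y ▷ x)`. -/
noncomputable def derived : YBSolution X where
  r p := (p.2, S.tri p.2 p.1)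
  bijective := by
    constructor
    · rintro ⟨x, y⟩ ⟨x', y'⟩ h
      obtain ⟨h1, h2⟩ := Prod.mk.inj h
      simp only at h1 h2
      subst h1
      rw [(S.tri_bijective y).1 h2]
    · rintro ⟨y, z⟩
      obtain ⟨x, hx⟩ := (S.tri_bijective y).2 z
      exact ⟨(x, y), by simp only [hx]⟩
  yang_baxter := by
    funext ⟨x, y, z⟩
    simp only [Function.comp, S.tri_tri x y z]

/-- The derived solution of `(X, r)` is indecomposable: the group generated by all the
permutations `x ↦ y ▷ x` acts transitively on `X`. -/
def DerivedIndecomposable : Prop :=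
  MulAction.IsPretransitive (Subgroup.closure (Set.range S.triPerm)) X

/-! ### The skew left brace structure on the structure group -/

theorem sigma_symm_injective :
    Function.Injective (fun y => (S.sigmaPerm y).symm y) := by
  have key : ∀ y z, S.sigma y z = y → S.tau z y = S.tri z z := by
    intro y z h
    apply (hS.sigma_bijective y).1
    rw [sigma_tri, h]
    conv_rhs => rw [← h, h]
    have := S.tri_sigma y z
    rw [h] at this
    exact this.symm
  intro y y' h
  have h1 : S.sigma y ((S.sigmaPerm y).symm y) = y := (S.sigmaPerm y).apply_symm_apply y
  have h2 : S.sigma y' ((S.sigmaPerm y').symm y') = y' := (S.sigmaPerm y').apply_symm_apply y'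
  simp only at h
  rw [← h] at h2
  exact (hS.tau_bijective _).1 ((key _ _ h1).trans (key _ _ h2).symm)

/-- The action of `G(X, r)` on `X` through the permutations `σ_x`. -/
noncomputable def act : S.StructureGroup →* Equiv.Perm X :=
  PresentedGroup.toGroup (rels := S.structureRels) (f := S.sigmaPerm) <| by
    rintro _ ⟨x, y, rfl⟩
    simp only [map_mul, map_inv, FreeGroup.lift_apply_of, mul_inv_eq_one]
    ext z
    exact S.sigma_sigma x y z

@[simp] theorem act_iota (x : X) : S.act (S.iota x) = S.sigmaPerm x :=
  PresentedGroup.toGroup.of _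

theorem act_tri (g : S.StructureGroup) :
    ∀ z x : X, S.act g (S.tri z x) = S.tri (S.act g z) (S.act g x) := by
  induction g using S.structureGroup_induction with
  | iota y => intro z x; simpa using S.sigma_tri y z x
  | one => simp
  | mul g h hg hh => intro z x; simp [hg, hh]
  | inv g hg => intro z x; rw [map_inv, Equiv.Perm.inv_eq_iff_eq, hg]; simp

/-- The defining relations of `A(X, r)`, in the form `x + z = z + (z ▷ x)`. -/
theorem derived_rel (x z : X) :
    (PresentedGroup.of x * PresentedGroup.of z : S.DerivedGroup) =
      PresentedGroup.of z * PresentedGroup.of (S.tri z x) := by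
  obtain ⟨y, rfl⟩ := (hS.sigma_bijective x).2 z
  rw [tri_sigma]
  exact mul_inv_eq_one.1 (PresentedGroup.one_of_mem (rels := S.additiveRels) ⟨x, y, rfl⟩)

/-- Homomorphisms out of `A(X, r)`. -/
def derivedLift {G : Type*} [Group G] (f : X → G)
    (h : ∀ x z, f x * f z = f z * f (S.tri z x)) : S.DerivedGroup →* G :=
  PresentedGroup.toGroup (rels := S.additiveRels) (f := f) <| by
    rintro _ ⟨x, y, rfl⟩
    simp only [map_mul, map_inv, FreeGroup.lift_apply_of, mul_inv_eq_one]
    rw [h, tri_sigma]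

@[simp] theorem derivedLift_of {G : Type*} [Group G] (f : X → G)
    (h : ∀ x z, f x * f z = f z * f (S.tri z x)) (x : X) :
    S.derivedLift f h (PresentedGroup.of x) = f x :=
  PresentedGroup.toGroup.of _

/-- The endomorphism `x ↦ g(x)` of `A(X, r)`. -/
noncomputable def lamHom (g : S.StructureGroup) : S.DerivedGroup →* S.DerivedGroup :=
  S.derivedLift (fun x => PresentedGroup.of (S.act g x)) fun x z => by
    rw [act_tri, derived_rel]

@[simp] theorem lamHom_of (g : S.StructureGroup) (x : X) :
    S.lamHom g (PresentedGroup.of x) = PresentedGroup.of (S.act g x) :=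
  S.derivedLift_of _ _ x

theorem lamHom_mul (g h : S.StructureGroup) :
    S.lamHom (g * h) = (S.lamHom g).comp (S.lamHom h) :=
  PresentedGroup.ext fun x => by simp

theorem lamHom_one : S.lamHom 1 = MonoidHom.id _ :=
  PresentedGroup.ext fun x => by simp

/-- The action of `G(X, r)` on `A(X, r)` by automorphisms, extending the action on `X`. -/
noncomputable def lamAut : S.StructureGroup →* MulAut S.DerivedGroup where
  toFun g := MonoidHom.toMulEquiv (S.lamHom g) (S.lamHom g⁻¹)
    (by rw [← lamHom_mul, inv_mul_cancel, lamHom_one])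
    (by rw [← lamHom_mul, mul_inv_cancel, lamHom_one])
  map_one' := MulEquiv.ext fun a => DFunLike.congr_fun S.lamHom_one a
  map_mul' g h := MulEquiv.ext fun a => DFunLike.congr_fun (S.lamHom_mul g h) a

@[simp] theorem lamAut_of (g : S.StructureGroup) (x : X) :
    S.lamAut g (PresentedGroup.of x) = PresentedGroup.of (S.act g x) :=
  S.lamHom_of g x

/-- The homomorphism `g ↦ (π(g), g)` into the semidirect product. -/
noncomputable def cocycleHom :
    S.StructureGroup →* S.DerivedGroup ⋊[S.lamAut] S.StructureGroup :=
  PresentedGroup.toGroup (rels := S.structureRels)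
    (f := fun x => ⟨PresentedGroup.of x, S.iota x⟩) <| by
    rintro _ ⟨x, y, rfl⟩
    simp only [map_mul, map_inv, FreeGroup.lift_apply_of, mul_inv_eq_one]
    apply SemidirectProduct.ext
    · simp only [SemidirectProduct.mul_left, lamAut_of, act_iota, sigmaPerm_apply]
      rw [derived_rel, tri_sigma]
    · exact S.iota_mul x y

theorem cocycleHom_iota (x : X) :
    S.cocycleHom (S.iota x) = ⟨PresentedGroup.of x, S.iota x⟩ :=
  PresentedGroup.toGroup.of _

theorem cocycleHom_right (g : S.StructureGroup) : (S.cocycleHom g).right = g := by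
  have : SemidirectProduct.rightHom.comp S.cocycleHom = MonoidHom.id _ :=
    S.structureGroup_hom_ext fun x => by simp [cocycleHom_iota]
  exact DFunLike.congr_fun this g

/-- The bijective 1-cocycle `π : G(X, r) → A(X, r)` with `π(x) = x` for `x ∈ X`. -/
noncomputable def cocycle (g : S.StructureGroup) : S.DerivedGroup := (S.cocycleHom g).left

@[simp] theorem cocycle_iota (x : X) : S.cocycle (S.iota x) = PresentedGroup.of x := by
  simp [cocycle, cocycleHom_iota]

@[simp] theorem cocycle_one : S.cocycle 1 = 1 := by
  simp [cocycle]

theorem cocycle_mul (g h : S.StructureGroup) :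
    S.cocycle (g * h) = S.cocycle g * S.lamAut g (S.cocycle h) := by
  simp [cocycle, cocycleHom_right]

variable [Finite X]

/-- The permutation `y ↦ σ_y⁻¹(y)` of `X`. -/
noncomputable def diagPerm : Equiv.Perm X :=
  Equiv.ofBijective _ (Finite.injective_iff_bijective.1 S.sigma_symm_injective)

/-- The permutation `g ↦ g ∘ λ_g⁻¹(x)` of `G(X, r)`. -/
noncomputable def translate (x : X) : Equiv.Perm S.StructureGroup where
  toFun g := g * S.iota ((S.act g).symm x)
  invFun h := h * (S.iota (S.diagPerm.symm ((S.act h).symm x)))⁻¹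
  left_inv g := by
    have : S.diagPerm.symm ((S.act (g * S.iota ((S.act g).symm x))).symm x)
        = (S.act g).symm x := by
      rw [Equiv.symm_apply_eq, map_mul, act_iota]
      rfl
    simp only [this, mul_inv_cancel_right]
  right_inv h := by
    change (h * (S.iota (S.diagPerm.symm ((S.act h).symm x)))⁻¹) * S.iota ((S.act
      (h * (S.iota (S.diagPerm.symm ((S.act h).symm x)))⁻¹)).symm x) = h
    set y := S.diagPerm.symm ((S.act h).symm x) with hy
    have h1 : (S.act h).symm x = (S.sigmaPerm y).symm y := by
      rw [hy]
      exact (S.diagPerm.apply_symm_apply _).symm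
    have : (S.act (h * (S.iota y)⁻¹)).symm x = y := by
      rw [map_mul, map_inv, act_iota]
      change (S.sigmaPerm y) ((S.act h).symm x) = y
      rw [h1, Equiv.apply_symm_apply]
    rw [this, inv_mul_cancel_right]

theorem translate_apply (x : X) (g : S.StructureGroup) :
    S.translate x g = g * S.iota ((S.act g).symm x) := rfl

/-- The right action `(g, a) ↦ g + a` of `A(X, r)` on `G(X, r)`. -/
noncomputable def rightAct : S.DerivedGroup →* (Equiv.Perm S.StructureGroup)ᵐᵒᵖ :=
  S.derivedLift (fun x => MulOpposite.op (S.translate x)) fun x z => by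
    rw [← MulOpposite.op_mul, ← MulOpposite.op_mul]
    congr 1
    ext g
    simp only [Equiv.Perm.mul_apply, translate_apply, map_mul, act_iota, mul_assoc]
    congr 1
    set u := (S.act g).symm x with hu
    set v := (S.act g).symm z with hv
    have e1 : (S.act g * S.sigmaPerm u).symm z = (S.sigmaPerm u).symm v := rfl
    have e2 : (S.act g * S.sigmaPerm v).symm (S.tri z x)
        = (S.sigmaPerm v).symm (S.tri v u) := by
      have : S.tri z x = S.act g (S.tri v u) := by simp [act_tri, hu, hv]
      rw [this]
      exact congrArg (S.sigmaPerm v).symm ((S.act g).symm_apply_apply (S.tri v u))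
    rw [e1, e2]
    obtain ⟨w, hw⟩ := (hS.sigma_bijective u).2 v
    rw [← hw, tri_sigma, ← sigmaPerm_apply S u w, Equiv.symm_apply_apply, sigmaPerm_apply,
      ← sigmaPerm_apply S (S.sigma u w) (S.tau w u), Equiv.symm_apply_apply]
    exact S.iota_mul u w

/-- The right action `(g, a) ↦ g + a` of `A(X, r)` on `G(X, r)`. -/
noncomputable def addRight (g : S.StructureGroup) (a : S.DerivedGroup) : S.StructureGroup :=
  (S.rightAct a).unop g

theorem addRight_of (g : S.StructureGroup) (x : X) :
    S.addRight g (PresentedGroup.of x) = g * S.iota ((S.act g).symm x) := by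
  simp [addRight, rightAct, translate_apply]

theorem addRight_one (g : S.StructureGroup) : S.addRight g 1 = g := by
  simp [addRight]

theorem addRight_mul (g : S.StructureGroup) (a b : S.DerivedGroup) :
    S.addRight g (a * b) = S.addRight (S.addRight g a) b := by
  simp [addRight]

theorem cocycle_addRight (a : S.DerivedGroup) :
    ∀ g, S.cocycle (S.addRight g a) = S.cocycle g * a := by
  induction a using S.derivedGroup_induction with
  | of x => intro g; simp [addRight_of, cocycle_mul]
  | one => simp [addRight_one]
  | mul a b ha hb => intro g; rw [addRight_mul, hb, ha, mul_assoc]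
  | inv a ha =>
    intro g
    rw [eq_mul_inv_iff_mul_eq, ← ha, ← addRight_mul, inv_mul_cancel, addRight_one]

theorem mul_addRight (g : S.StructureGroup) (a : S.DerivedGroup) :
    ∀ h, S.addRight (g * h) (S.lamAut g a) = g * S.addRight h a := by
  induction a using S.derivedGroup_induction with
  | of x =>
    intro h
    have : (S.act g * S.act h).symm (S.act g x) = (S.act h).symm x :=
      congrArg (S.act h).symm ((S.act g).symm_apply_apply x)
    simp [addRight_of, this, mul_assoc]
  | one => simp [addRight_one]
  | mul a b ha hb => intro h; rw [map_mul, addRight_mul, ha, hb, addRight_mul]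
  | inv a ha =>
    intro h
    have h1 := ha (S.addRight h a⁻¹)
    rw [← addRight_mul, inv_mul_cancel, addRight_one] at h1
    rw [← h1, ← addRight_mul, map_inv, mul_inv_cancel, addRight_one]

theorem addRight_cocycle (g : S.StructureGroup) : S.addRight 1 (S.cocycle g) = g := by
  induction g using S.structureGroup_induction with
  | iota x => rw [cocycle_iota, addRight_of, map_one, one_mul]; rfl
  | one => simp [addRight_one]
  | mul g h hg hh =>
    rw [cocycle_mul, addRight_mul, hg]
    have h1 := S.mul_addRight g (S.cocycle h) 1
    rwa [mul_one, hh] at h1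
  | inv g hg =>
    have h1 := S.mul_addRight g⁻¹ (S.cocycle g) 1
    rw [hg, mul_one, inv_mul_cancel] at h1
    have h2 : S.lamAut g⁻¹ (S.cocycle g) = (S.cocycle g⁻¹)⁻¹ := by
      apply eq_inv_of_mul_eq_one_right
      rw [← cocycle_mul, inv_mul_cancel, cocycle_one]
    rw [h2] at h1
    rw [← h1, ← addRight_mul, inv_mul_cancel, addRight_one]

/-- The cocycle as a bijection from `G(X, r)` to `A(X, r)`. -/
noncomputable def cocycleEquiv : S.StructureGroup ≃ S.DerivedGroup where
  toFun := S.cocycle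
  invFun := S.addRight 1
  left_inv := S.addRight_cocycle
  right_inv a := by rw [cocycle_addRight, cocycle_one, one_mul]

/-- The structure skew left brace `G(X, r)`: its multiplicative group is the structure group,
and its additive group is `A(X, r)`, identified with `G(X, r)` through the bijective
1-cocycle that is the identity on `X`. -/
noncomputable instance : SkewLeftBrace S.StructureGroup :=
  { (inferInstance : Group S.StructureGroup),
    (S.cocycleEquiv.trans Additive.ofMul).addGroup with
    mul_add_eq := fun a b c => by
      apply S.cocycleEquiv.injective
      change S.cocycle (a * S.cocycleEquiv.symm (S.cocycle b * S.cocycle c)) =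
        S.cocycleEquiv (S.cocycleEquiv.symm (S.cocycleEquiv (S.cocycleEquiv.symm
          (S.cocycle (a * b) / S.cocycle a)) * S.cocycle (a * c)))
      have h : ∀ d, S.cocycle (S.cocycleEquiv.symm d) = d := S.cocycleEquiv.apply_symm_apply
      rw [Equiv.apply_symm_apply, Equiv.apply_symm_apply, cocycle_mul, cocycle_mul,
        cocycle_mul, h, map_mul, div_eq_mul_inv]
      group }

theorem cocycle_add (a b : S.StructureGroup) :
    S.cocycle (a + b) = S.cocycle a * S.cocycle b :=
  S.cocycleEquiv.apply_symm_apply _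

/-- The skew left brace `G(X, r)` is compatible with the solution:
`r_{G(X, r)} (ι × ι) = (ι × ι) r`. -/
theorem braceMap_iota (p : X × X) :
    SkewLeftBrace.braceMap (Prod.map S.iota S.iota p) = Prod.map S.iota S.iota (S.r p) := by
  obtain ⟨x, y⟩ := p
  have h : SkewLeftBrace.lam (S.iota x) (S.iota y) = S.iota (S.sigma x y) := by
    rw [SkewLeftBrace.lam, neg_add_eq_iff_eq_add]
    apply S.cocycleEquiv.injective
    change S.cocycle _ = S.cocycle _
    rw [cocycle_add, cocycle_mul]
    simp
  refine Prod.ext h ?_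
  change (SkewLeftBrace.lam (S.iota x) (S.iota y))⁻¹ * S.iota x * S.iota y = S.iota (S.tau y x)
  rw [h, mul_assoc, iota_mul, inv_mul_cancel_left]

end NonDegenerate
end YBSolution

/-!
The defining relations of `A(X, r)` say that `z ▷ x` is the conjugate of `x` by `z`. Hence an element
of `A(X, r)` acting trivially on the finite set `X` commutes with all generators, so the centre of
`A(X, r)` has finite index, and by Schur's theorem the commutator subgroup of `A(X, r)` is finite.

If the derived solution is indecomposable, all generators are conjugate, so the abelianization of
`A(X, r)` is infinite cyclic, and the commutator subgroup is the kernel of the degree map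
`A(X, r) → ℤ` sending every generator to `1`. The degree is invariant under all `λ_g`, because these
permute the generators. Thus `a * b = λ_a(b) - b` always has degree `0`, which proves that
`G(X, r) * G(X, r)` is finite. By the same invariance the degree is also a homomorphism for the
multiplicative group, so the elements of degree `0` form a finite multiplicative subgroup.
Either it contains a non-identity element, which then has finite order, or the degree is an
isomorphism of skew left braces onto the trivial skew left brace `ℤ`.
-/

/-- A commutator depends only on the classes of its entries modulo the centre. -/
theorem finite_commutatorSet_of_finiteIndex_center (G : Type*) [Group G]
    [(Subgroup.center G).FiniteIndex] : Finite (commutatorSet G) := by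
  have key : ∀ g : G, ∃ z ∈ Subgroup.center G, (g : G ⧸ Subgroup.center G).out = g * z :=
    fun g => (QuotientGroup.mk_out_eq_mul _ g).elim fun z hz => ⟨z, z.2, hz⟩
  refine ((Set.finite_range fun p : (G ⧸ Subgroup.center G) × (G ⧸ Subgroup.center G) =>
    p.1.out * p.2.out * p.1.out⁻¹ * p.2.out⁻¹).subset ?_).to_subtype
  rintro _ ⟨a, b, rfl⟩
  refine ⟨(a, b), ?_⟩
  obtain ⟨z, hz, ha⟩ := key a
  obtain ⟨w, hw, hb⟩ := key b
  rw [Subgroup.mem_center_iff] at hz hw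
  have hw' : w * a⁻¹ = a⁻¹ * w := (hw a⁻¹).symm
  rw [commutatorElement_def]
  simp only [ha, hb]
  calc a * z * (b * w) * (a * z)⁻¹ * (b * w)⁻¹
      = a * (z * (b * w)) * z⁻¹ * a⁻¹ * w⁻¹ * b⁻¹ := by group
    _ = a * b * (w * a⁻¹) * w⁻¹ * b⁻¹ := by rw [← hz]; group
    _ = a * b * a⁻¹ * b⁻¹ := by rw [hw']; group

namespace YBSolution

variable {X : Type*} (S : YBSolution X) [S.NonDegenerate]

/-- The right action of `A(X, r)` on `X` in which the generator `z` acts by `x ↦ z ▷ x`. -/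
noncomputable def triAct : S.DerivedGroup →* (Equiv.Perm X)ᵐᵒᵖ :=
  S.derivedLift (fun z => MulOpposite.op (S.triPerm z)) fun x z => by
    rw [← MulOpposite.op_mul, ← MulOpposite.op_mul]
    congr 1
    ext y
    exact S.tri_tri y x z

/-- The right action `triAct` describes conjugation of the generators. -/
theorem of_mul_eq_mul_of_triAct (a : S.DerivedGroup) :
    ∀ x, (PresentedGroup.of x * a : S.DerivedGroup) =
      a * PresentedGroup.of ((S.triAct a).unop x) := by
  induction a using S.derivedGroup_induction with
  | of z =>
    intro x
    rw [triAct, derivedLift_of]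
    exact S.derived_rel x z
  | one => simp
  | mul a b ha hb =>
    intro x
    rw [← mul_assoc, ha, mul_assoc, hb, ← mul_assoc, map_mul]
    rfl
  | inv a ha =>
    intro x
    rw [eq_inv_mul_iff_mul_eq, ← mul_assoc, mul_inv_eq_iff_eq_mul, ha]
    simp

theorem ker_triAct_le_center : S.triAct.ker ≤ Subgroup.center S.DerivedGroup := by
  intro a ha
  rw [Subgroup.mem_center_iff]
  intro b
  induction b using S.derivedGroup_induction with
  | of x => simpa [MonoidHom.mem_ker.1 ha] using S.of_mul_eq_mul_of_triAct a x
  | one => simp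
  | mul b c hb hc => rw [mul_assoc, hc, ← mul_assoc, hb, mul_assoc]
  | inv b hb => exact (Commute.inv_left (show Commute b a from hb)).eq

theorem finite_commutator_derivedGroup [Finite X] : Finite (commutator S.DerivedGroup) := by
  have : Finite (Equiv.Perm X)ᵐᵒᵖ := Finite.of_equiv _ MulOpposite.opEquiv
  have : S.triAct.ker.FiniteIndex := inferInstance
  have : (Subgroup.center S.DerivedGroup).FiniteIndex :=
    Subgroup.finiteIndex_of_le S.ker_triAct_le_center
  have := finite_commutatorSet_of_finiteIndex_center S.DerivedGroup
  -- Schur's theorem, as an instance: finitely many commutators generate a finite subgroup.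
  infer_instance

/-- The degree map `A(X, r) → ℤ`, sending every generator to `1`. -/
noncomputable def degree : S.DerivedGroup →* Multiplicative ℤ :=
  S.derivedLift (fun _ => Multiplicative.ofAdd 1) fun _ _ => rfl

@[simp] theorem degree_of (x : X) : S.degree (PresentedGroup.of x) = Multiplicative.ofAdd 1 :=
  S.derivedLift_of _ _ x

theorem degree_lamAut (g : S.StructureGroup) (a : S.DerivedGroup) :
    S.degree (S.lamAut g a) = S.degree a := by
  have : S.degree.comp (S.lamAut g).toMonoidHom = S.degree :=
    PresentedGroup.ext fun x => by simp
  exact DFunLike.congr_fun this a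

variable {S} in
theorem DerivedIndecomposable.isConj_of (h : S.DerivedIndecomposable) (x y : X) :
    IsConj (PresentedGroup.of x : S.DerivedGroup) (PresentedGroup.of y) := by
  obtain ⟨⟨p, hp⟩, rfl⟩ := h.exists_smul_eq x y
  change IsConj _ (PresentedGroup.of (p x))
  induction hp using Subgroup.closure_induction generalizing x with
  | mem p hp =>
    obtain ⟨z, rfl⟩ := hp
    refine isConj_iff.2 ⟨(PresentedGroup.of z)⁻¹, ?_⟩
    rw [inv_inv, mul_assoc, inv_mul_eq_iff_eq_mul]
    exact S.derived_rel x z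
  | one => exact IsConj.refl _
  | mul p q _ _ hp hq => exact (hq x).trans (hp (q x))
  | inv p _ hp => simpa using (hp (p⁻¹ x)).symm

variable {S} in
/-- When all generators are conjugate, the abelianization of `A(X, r)` is generated by the
class of any one of them, and the degree recovers the exponent. -/
theorem DerivedIndecomposable.ker_degree_le_commutator [Nonempty X]
    (h : S.DerivedIndecomposable) : S.degree.ker ≤ commutator S.DerivedGroup := by
  let x₀ : X := Classical.arbitrary X
  have key : (zpowersHom _ (Abelianization.of (PresentedGroup.of x₀ : S.DerivedGroup))).comp
      S.degree = Abelianization.of :=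
    PresentedGroup.ext fun x => by
      simpa using isConj_iff_eq.1 (Abelianization.of.map_isConj (h.isConj_of x₀ x))
  intro a ha
  rw [← Abelianization.ker_of, MonoidHom.mem_ker, ← key, MonoidHom.comp_apply,
    MonoidHom.mem_ker.1 ha, map_one]

/-- The degree on the structure group, as a homomorphism on the multiplicative group. -/
noncomputable def structureDegree : S.StructureGroup →* Multiplicative ℤ where
  toFun g := S.degree (S.cocycle g)
  map_one' := by simp
  map_mul' g h := by rw [cocycle_mul, map_mul, degree_lamAut]

theorem structureDegree_iota (x : X) :
    S.structureDegree (S.iota x) = Multiplicative.ofAdd 1 := by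
  simp [structureDegree]

theorem structureDegree_surjective [Nonempty X] : Function.Surjective S.structureDegree := by
  intro n
  refine ⟨S.iota (Classical.arbitrary X) ^ n.toAdd, ?_⟩
  rw [map_zpow, structureDegree_iota, ← ofAdd_zsmul]
  simp

variable [Finite X]

/-- The degree on the structure group, as a homomorphism on the additive group. -/
noncomputable def structureDegreeAdd : S.StructureGroup →+ ℤ where
  toFun g := (S.structureDegree g).toAdd
  map_zero' := by
    have h0 : S.cocycle (0 : S.StructureGroup) = 1 := S.cocycleEquiv.apply_symm_apply 1
    simp [structureDegree, h0]
  map_add' a b := by simp [structureDegree, cocycle_add]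

theorem structureDegreeAdd_apply (g : S.StructureGroup) :
    S.structureDegreeAdd g = (S.structureDegree g).toAdd := rfl

theorem starSubgroup_le_ker_structureDegreeAdd :
    SkewLeftBrace.starSubgroup S.StructureGroup ≤ S.structureDegreeAdd.ker := by
  refine (AddSubgroup.closure_le _).2 ?_
  rintro _ ⟨a, b, rfl⟩
  have hmul : S.structureDegreeAdd (a * b) = S.structureDegreeAdd a + S.structureDegreeAdd b := by
    simp [structureDegreeAdd_apply]
  simp [AddMonoidHom.mem_ker, SkewLeftBrace.star, sub_eq_add_neg, hmul]

variable {S} in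
theorem DerivedIndecomposable.finite_ker_structureDegree [Nonempty X]
    (h : S.DerivedIndecomposable) : (S.structureDegree.ker : Set S.StructureGroup).Finite := by
  have := S.finite_commutator_derivedGroup
  have hfin : (commutator S.DerivedGroup : Set S.DerivedGroup).Finite := Set.toFinite _
  exact (hfin.preimage S.cocycleEquiv.injective.injOn).subset
    fun g hg => h.ker_degree_le_commutator hg

end YBSolution

theorem mainTheorem1 {X : Type*} [Finite X] [Nonempty X] (S : YBSolution X)
    [S.NonDegenerate] (h : S.DerivedIndecomposable) :
    (SkewLeftBrace.starSubgroup S.StructureGroup : Set S.StructureGroup).Finite ∧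
      (¬ SkewLeftBrace.IsIsoTrivial S.StructureGroup ℤ →
        ∃ g : S.StructureGroup, g ≠ 1 ∧ IsOfFinOrder g) := by
  refine ⟨h.finite_ker_structureDegree.subset
    fun g hg => S.starSubgroup_le_ker_structureDegreeAdd hg, fun hZ => ?_⟩
  have : Finite S.structureDegree.ker := h.finite_ker_structureDegree.to_subtype
  by_contra! hno
  -- Without torsion the finite kernel of the degree is trivial.
  refine hZ ⟨Equiv.ofBijective S.structureDegreeAdd ⟨?_, S.structureDegree_surjective⟩,
    fun a b => ⟨map_add S.structureDegreeAdd a b, congrArg Multiplicative.toAdd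
      (map_mul S.structureDegree a b)⟩⟩
  refine (injective_iff_map_eq_one S.structureDegree).2 fun g hg => ?_
  by_contra hg1
  exact hno g hg1 (Submonoid.isOfFinOrder_coe.2
    (isOfFinOrder_of_finite (⟨g, hg⟩ : S.structureDegree.ker)))
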